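/- Let $n \le 4$ and let $S = (s_{ij})$ be a real symmetric positive-definite $n \times n$ matrix. Call $S$ \emph{Venkov-reduced with respect to $I_n$} if $\operatorname{Trace}(S) \le \operatorname{Trace}(g S g^{T})$ for all $g \in GL_n(\mathbb{Z})$. Call a positive-definite matrix $T = (t_{ij})$ \emph{Minkowski-reduced} if for every $i = 1, \dots, n$, $$t_{ii} = \min\{ v^{T} T v : v \in \mathbb{Z}^n,\ \mathbf{e}_1, \dots, \mathbf{e}_{i-1}, v \text{ are distinct and are part of a } \mathbb{Z}\text{-basis of } \mathbb{Z}^n \},$$ where $\mathbf{e}_1, \dots, \mathbf{e}_n$ is the standard basis. Then $S$ is Venkov-reduced with respect to $I_n$ if and only if $g S g^{T}$ is Minkowski-reduced for some permutation matrix $g \in GL_n(\mathbb{Z})$. -/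

import Mathlib

namespace LatticeReduction

open Matrix

/-- The congruence action `g S gᵀ` of `g ∈ GL_n(ℤ)` on real `n × n` matrices. -/
noncomputable def act {n : ℕ} (g : GL (Fin n) ℤ) (S : Matrix (Fin n) (Fin n) ℝ) :
    Matrix (Fin n) (Fin n) ℝ :=
  (g : Matrix (Fin n) (Fin n) ℤ).map (Int.cast : ℤ → ℝ) * S *
    ((g : Matrix (Fin n) (Fin n) ℤ).map (Int.cast : ℤ → ℝ))ᵀ

/-- The inner product `S • T = Trace (S T)`. -/
def bullet {n : ℕ} (S T : Matrix (Fin n) (Fin n) ℝ) : ℝ := (S * T).trace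

/-- The value `vᵀ S v` of the quadratic form of `S` at an integral vector `v`. -/
def quadValue {n : ℕ} (S : Matrix (Fin n) (Fin n) ℝ) (v : Fin n → ℤ) : ℝ :=
  (fun j => (v j : ℝ)) ⬝ᵥ (S *ᵥ fun j => (v j : ℝ))

/-- A family of (pairwise distinct) vectors of `ℤⁿ` is a primitive set if it is part of a
`ℤ`-basis of `ℤⁿ`. -/
def IsPrimitiveSet {n : ℕ} {ι : Type*} (v : ι → Fin n → ℤ) : Prop :=
  Function.Injective v ∧
    ∃ b : Module.Basis (Fin n) ℤ (Fin n → ℤ), Set.range v ⊆ Set.range b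

/-- The family `e_1, …, e_{i-1}, v`, indexed by the `j ≤ i`. -/
def stdThen {n : ℕ} (i : Fin n) (v : Fin n → ℤ) : Set.Iic i → Fin n → ℤ :=
  fun j => if (j : Fin n) < i then Pi.single (j : Fin n) 1 else v

/-- A positive-definite `S` is Minkowski-reduced if, for every `i`, its entry `s_{ii}` is the
minimum of `vᵀ S v` over all `v` such that `e_1, …, e_{i-1}, v` is a primitive set. -/
def IsMinkowskiReduced {n : ℕ} (S : Matrix (Fin n) (Fin n) ℝ) : Prop :=
  S.PosDef ∧
    ∀ i : Fin n, IsLeast (quadValue S '' {v | IsPrimitiveSet (stdThen i v)}) (S i i)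

/-- A positive-definite `S` is Venkov-reduced with respect to a (positive-definite) `S₀` if
`S • S₀ ≤ (g S gᵀ) • S₀` for all `g ∈ GL_n(ℤ)`. -/
def IsVenkovReduced {n : ℕ} (S₀ S : Matrix (Fin n) (Fin n) ℝ) : Prop :=
  S.PosDef ∧ ∀ g : GL (Fin n) ℤ, bullet S S₀ ≤ bullet (act g S) S₀

/-- `g ∈ GL_n(ℤ)` is a permutation matrix. -/
def IsPermutationMatrix {n : ℕ} (g : GL (Fin n) ℤ) : Prop :=
  ∃ σ : Equiv.Perm (Fin n), (g : Matrix (Fin n) (Fin n) ℤ) = σ.permMatrix ℤ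

end LatticeReduction

namespace LatticeReduction

open Matrix

/-! Write Q for the form of S. Up to ordering the diagonal, both notions amount to
`IsSupportMinimal`. Each reduction yields the weaker `IsUnitMinimal`, because replacing row k of the
identity by v is unimodular when v k = ±1. The bound n ≤ 4 upgrades it
(`IsUnitMinimal.le_of_isMax`): scale v to have k-th coordinate 1 and round the other n - 1 ≤ 3
coordinates, each costing at most a quarter of s_kk. Conversely, a nonzero term of det g matches
rows with diagonal entries, giving the trace inequality, and a sorted diagonal gives Minkowski
reduction. -/

/-- The real quadratic form `xᵀ S x`. -/
noncomputable def realForm {n : ℕ} (S : Matrix (Fin n) (Fin n) ℝ) (x : Fin n → ℝ) : ℝ :=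
  x ⬝ᵥ (S *ᵥ x)

/-- Integral vectors with `k`-th coordinate `±1` have value at least `s_kk`. -/
def IsUnitMinimal {n : ℕ} (S : Matrix (Fin n) (Fin n) ℝ) : Prop :=
  ∀ (v : Fin n → ℤ) (k : Fin n), IsUnit (v k) → S k k ≤ quadValue S v

/-- Integral vectors with nonzero `k`-th coordinate have value at least `s_kk`. -/
def IsSupportMinimal {n : ℕ} (S : Matrix (Fin n) (Fin n) ℝ) : Prop :=
  ∀ (v : Fin n → ℤ) (k : Fin n), v k ≠ 0 → S k k ≤ quadValue S v

theorem quadValue_eq_realForm {n : ℕ} (S : Matrix (Fin n) (Fin n) ℝ) (v : Fin n → ℤ) :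
    quadValue S v = realForm S (fun j => (v j : ℝ)) := rfl

theorem realForm_smul {n : ℕ} (S : Matrix (Fin n) (Fin n) ℝ) (c : ℝ) (x : Fin n → ℝ) :
    realForm S (c • x) = c ^ 2 * realForm S x := by
  simp only [realForm, mulVec_smul, smul_dotProduct, dotProduct_smul, smul_eq_mul]
  ring

theorem realForm_add_single {n : ℕ} (S : Matrix (Fin n) (Fin n) ℝ) (x : Fin n → ℝ) (i : Fin n)
    (t : ℝ) :
    realForm S (x + Pi.single i t) = realForm S x
      + t * (x ⬝ᵥ (S *ᵥ Pi.single i 1) + (S *ᵥ x) i) + t ^ 2 * S i i := by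
  have h : (Pi.single i t : Fin n → ℝ) = t • Pi.single i 1 := by
    rw [← Pi.single_smul, smul_eq_mul, mul_one]
  rw [h]
  simp only [realForm, mulVec_add, mulVec_smul, add_dotProduct, dotProduct_add, smul_dotProduct,
    dotProduct_smul, smul_eq_mul, single_one_dotProduct]
  simp
  ring

theorem quadValue_single {n : ℕ} (S : Matrix (Fin n) (Fin n) ℝ) (i : Fin n) :
    quadValue S (Pi.single i 1) = S i i := by
  have h : (fun j => (((Pi.single i 1 : Fin n → ℤ) j : ℤ) : ℝ)) = 0 + Pi.single i 1 := by
    ext j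
    by_cases hj : j = i
    · subst hj; simp
    · simp [hj]
  rw [quadValue_eq_realForm, h, realForm_add_single]
  simp [realForm]

/-- Rounding one coordinate increases the form by at most a quarter of the diagonal entry. -/
theorem exists_round_coordinate {n : ℕ} (S : Matrix (Fin n) (Fin n) ℝ) (x : Fin n → ℝ)
    (i : Fin n) (hi : 0 ≤ S i i) :
    ∃ a : ℤ, realForm S (Function.update x i a) ≤ realForm S x + S i i / 4 := by
  set f := Int.fract (x i)
  have hf0 : 0 ≤ f := Int.fract_nonneg _
  have hf1 : f < 1 := Int.fract_lt_one _
  have hx : x i = ⌊x i⌋ + f := (Int.floor_add_fract _).symm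
  have hup (t : ℝ) (a : ℤ) (h : (a : ℝ) = x i + t) :
      Function.update x i (a : ℝ) = x + Pi.single i t := by
    ext j
    by_cases hj : j = i
    · subst hj; simp [h]
    · simp [hj]
  by_contra! hcon
  have h0 := hcon ⌊x i⌋
  have h1 := hcon (⌊x i⌋ + 1)
  rw [hup (-f) _ (by linarith), realForm_add_single] at h0
  rw [hup (1 - f) _ (by push_cast; linarith), realForm_add_single] at h1
  set L := x ⬝ᵥ (S *ᵥ Pi.single i 1) + (S *ᵥ x) i
  -- Weights 1 - f and f on rounding down and up cancel the linear term, leaving f(1 - f) s_ii ≤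
  -- s_ii / 4.
  have h2 := mul_lt_mul_of_pos_left h0 (sub_pos.mpr hf1)
  have h3 := mul_le_mul_of_nonneg_left h1.le hf0
  nlinarith [mul_nonneg hi (sq_nonneg (f - 1 / 2))]

/-- Rounding the coordinates in `s`, leaving zero coordinates alone. -/
theorem exists_round_coordinates {n : ℕ} (S : Matrix (Fin n) (Fin n) ℝ) (x : Fin n → ℝ) (M : ℝ)
    (hM : 0 ≤ M) (hS : ∀ i, 0 ≤ S i i) (hx : ∀ i, x i ≠ 0 → S i i ≤ M) (s : Finset (Fin n)) :
    ∃ u : Fin n → ℝ, (∀ i ∈ s, ∃ a : ℤ, u i = a) ∧ (∀ i ∉ s, u i = x i) ∧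
      realForm S u ≤ realForm S x + s.card * (M / 4) := by
  induction s using Finset.induction_on with
  | empty => exact ⟨x, by simp, by simp, by simp⟩
  | insert i s hi ih =>
    obtain ⟨u, hus, hux, hu⟩ := ih
    rw [Finset.card_insert_of_notMem hi]
    push_cast
    -- `M` bounds s_ii only on the support of `x`.
    by_cases h0 : x i = 0
    · refine ⟨u, fun j hj => ?_, fun j hj => hux j fun h => hj (Finset.mem_insert_of_mem h), ?_⟩
      · rcases Finset.mem_insert.mp hj with rfl | hj
        · exact ⟨0, by rw [hux j hi, h0, Int.cast_zero]⟩
        · exact hus j hj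
      · linarith
    · obtain ⟨a, ha⟩ := exists_round_coordinate S u i (hS i)
      refine ⟨Function.update u i a, fun j hj => ?_, fun j hj => ?_, ?_⟩
      · by_cases hji : j = i
        · subst hji; exact ⟨a, by simp⟩
        · simpa [hji] using hus j (Finset.mem_of_mem_insert_of_ne hj hji)
      · rw [Finset.mem_insert, not_or] at hj
        rw [Function.update_of_ne hj.1, hux j hj.2]
      · linarith [hx i h0]

/-- If |v k| ≥ 2, rounding x = v / v k gives s_kk ≤ Q(x) + (3/4) s_kk, so Q(v) = (v k)² Q(x) ≥ 4 ·
s_kk / 4. -/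
theorem IsUnitMinimal.le_of_isMax {n : ℕ} (hn : n ≤ 4) {S : Matrix (Fin n) (Fin n) ℝ}
    (hS : ∀ i, 0 ≤ S i i) (h : IsUnitMinimal S) (v : Fin n → ℤ) (k : Fin n) (hk : v k ≠ 0)
    (hmax : ∀ i, v i ≠ 0 → S i i ≤ S k k) : S k k ≤ quadValue S v := by
  by_cases hu : IsUnit (v k)
  · exact h v k hu
  have hk' : (v k : ℝ) ≠ 0 := by exact_mod_cast hk
  have hd : (4 : ℝ) ≤ (v k : ℝ) ^ 2 := by
    have h2 : (2 : ℤ) ≤ |v k| := by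
      rw [Int.isUnit_iff] at hu
      grind
    have h3 : (4 : ℤ) ≤ v k ^ 2 := by
      rw [← sq_abs]; nlinarith
    exact_mod_cast h3
  set x : Fin n → ℝ := (v k : ℝ)⁻¹ • fun j => (v j : ℝ) with hxdef
  have hx (i : Fin n) (hi : x i ≠ 0) : S i i ≤ S k k := by
    refine hmax i fun h0 => hi ?_
    simp [hxdef, h0]
  obtain ⟨u, hus, hux, hle⟩ :=
    exists_round_coordinates S x (S k k) (hS k) hS hx (Finset.univ.erase k)
  have huk : u k = 1 := by
    rw [hux k (by simp)]
    simp [hxdef, hk']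
  have hint (i : Fin n) : ∃ a : ℤ, u i = a := by
    by_cases hi : i = k
    · exact ⟨1, by rw [hi, huk, Int.cast_one]⟩
    · exact hus i (by simp [hi])
  choose w hw using hint
  have hwk : w k = 1 := by
    have := hw k
    rw [huk] at this
    exact_mod_cast this.symm
  have h1 := h w k (by rw [hwk]; exact isUnit_one)
  have huw : u = fun j => (w j : ℝ) := funext hw
  rw [quadValue_eq_realForm, ← huw] at h1
  have hcard : ((Finset.univ.erase k).card : ℝ) ≤ 3 := by
    rw [Finset.card_erase_of_mem (Finset.mem_univ _), Finset.card_univ, Fintype.card_fin]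
    exact_mod_cast (by omega : n - 1 ≤ 3)
  have hxv : quadValue S v = (v k : ℝ) ^ 2 * realForm S x := by
    rw [hxdef, realForm_smul, quadValue_eq_realForm]
    field_simp
  have hq := mul_le_mul_of_nonneg_right hcard (div_nonneg (hS k) (by norm_num : (0 : ℝ) ≤ 4))
  have hxk : S k k / 4 ≤ realForm S x := by linarith
  rw [hxv]
  nlinarith [hS k]

theorem IsUnitMinimal.isSupportMinimal {n : ℕ} (hn : n ≤ 4) {S : Matrix (Fin n) (Fin n) ℝ}
    (hS : ∀ i, 0 ≤ S i i) (h : IsUnitMinimal S) : IsSupportMinimal S := by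
  intro v k hk
  -- The largest diagonal entry on the support of `v` dominates s_kk.
  obtain ⟨m, hm, hmax⟩ := Finset.exists_max_image (Finset.univ.filter fun i => v i ≠ 0)
    (fun i => S i i) ⟨k, by simp [hk]⟩
  simp only [Finset.mem_filter, Finset.mem_univ, true_and] at hm hmax
  exact (hmax k hk).trans (h.le_of_isMax hn hS v m hm hmax)

/-! ### Venkov reduction -/

theorem bullet_one_act {n : ℕ} (S : Matrix (Fin n) (Fin n) ℝ) (g : GL (Fin n) ℤ) :
    bullet (act g S) 1 = ∑ i, quadValue S ((g : Matrix (Fin n) (Fin n) ℤ) i) := by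
  simp only [bullet, mul_one, trace, diag_apply]
  refine Finset.sum_congr rfl fun i _ => ?_
  rw [act, Matrix.mul_assoc, Matrix.mul_apply, quadValue, dotProduct]
  rfl

theorem det_updateRow_one {n : ℕ} (k : Fin n) (v : Fin n → ℤ) :
    ((1 : Matrix (Fin n) (Fin n) ℤ).updateRow k v).det = v k := by
  have h2 := congrFun (LinearMap.congr_fun (cramer_one (n := Fin n) (α := ℤ)) v) k
  rw [cramer_apply] at h2
  rw [← det_transpose, ← updateCol_transpose, transpose_one]
  simpa using h2

theorem IsVenkovReduced.isUnitMinimal {n : ℕ} {S : Matrix (Fin n) (Fin n) ℝ}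
    (h : IsVenkovReduced 1 S) : IsUnitMinimal S := by
  intro v k hk
  have hdet : IsUnit ((1 : Matrix (Fin n) (Fin n) ℤ).updateRow k v).det := by
    rwa [det_updateRow_one]
  have hg := h.2 (Matrix.GeneralLinearGroup.mk'' _ hdet)
  rw [bullet_one_act] at hg
  simp only [bullet, mul_one, trace, diag_apply] at hg
  rw [← Finset.add_sum_erase _ _ (Finset.mem_univ k),
    ← Finset.add_sum_erase _ (fun i => quadValue S
      ((Matrix.GeneralLinearGroup.mk'' _ hdet : GL (Fin n) ℤ).val i)) (Finset.mem_univ k)] at hg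
  have hsum : ∑ i ∈ Finset.univ.erase k, quadValue S
      ((Matrix.GeneralLinearGroup.mk'' _ hdet : GL (Fin n) ℤ).val i) =
      ∑ i ∈ Finset.univ.erase k, S i i := by
    refine Finset.sum_congr rfl fun i hi => ?_
    have hrow : (Matrix.GeneralLinearGroup.mk'' _ hdet : GL (Fin n) ℤ).val i = Pi.single i 1 := by
      change (1 : Matrix (Fin n) (Fin n) ℤ).updateRow k v i = _
      rw [updateRow_ne (Finset.ne_of_mem_erase hi)]
      ext j
      simp [Matrix.one_apply, Pi.single_apply, eq_comm]
    rw [hrow, quadValue_single]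
  have hrow : (Matrix.GeneralLinearGroup.mk'' _ hdet : GL (Fin n) ℤ).val k = v := by
    change (1 : Matrix (Fin n) (Fin n) ℤ).updateRow k v k = _
    rw [updateRow_self]
  rw [hsum, hrow] at hg
  linarith

theorem IsSupportMinimal.isVenkovReduced {n : ℕ} {S : Matrix (Fin n) (Fin n) ℝ} (hS : S.PosDef)
    (h : IsSupportMinimal S) : IsVenkovReduced 1 S := by
  refine ⟨hS, fun g => ?_⟩
  have hdet : (g : Matrix (Fin n) (Fin n) ℤ).det ≠ 0 :=
    ((Matrix.isUnit_iff_isUnit_det _).mp g.isUnit).ne_zero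
  -- Some term of the Leibniz expansion of det g is nonzero.
  obtain ⟨σ, hσ⟩ : ∃ σ : Equiv.Perm (Fin n), ∀ i, (g : Matrix (Fin n) (Fin n) ℤ) (σ i) i ≠ 0 := by
    by_contra! hcon
    refine hdet ?_
    rw [det_apply]
    refine Finset.sum_eq_zero fun σ _ => ?_
    obtain ⟨i, hi⟩ := hcon σ
    exact smul_eq_zero_of_right _ (Finset.prod_eq_zero (Finset.mem_univ i) hi)
  rw [bullet_one_act, ← Equiv.sum_comp σ]
  simp only [bullet, mul_one, trace, diag_apply]
  exact Finset.sum_le_sum fun i _ => h _ i (hσ i)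

/-! ### Minkowski reduction -/

theorem stdThen_injective {n : ℕ} (i : Fin n) (v : Fin n → ℤ) (hv : v i ≠ 0) :
    Function.Injective (stdThen i v) := by
  rintro ⟨a, ha⟩ ⟨b, hb⟩ hab
  simp only [stdThen] at hab
  simp only [Set.mem_Iic] at ha hb
  simp only [Subtype.mk.injEq]
  split_ifs at hab with h1 h2 h2
  · by_contra hne
    have := congrFun hab a
    simp [hne] at this
  · exact absurd (by rw [← hab]; simp [h1.ne']) hv
  · exact absurd (by rw [hab]; simp [h2.ne']) hv
  · exact (le_antisymm ha (not_lt.mp h1)).trans (le_antisymm hb (not_lt.mp h2)).symm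

theorem isPrimitiveSet_stdThen {n : ℕ} (i : Fin n) (v : Fin n → ℤ) (hv : IsUnit (v i)) :
    IsPrimitiveSet (stdThen i v) := by
  refine ⟨stdThen_injective i v hv.ne_zero, ?_⟩
  set A := (1 : Matrix (Fin n) (Fin n) ℤ).updateRow i v with hA
  have hdet : IsUnit Aᵀ.det := by rwa [det_transpose, hA, det_updateRow_one]
  let e := Matrix.toLinearEquiv (Pi.basisFun ℤ (Fin n)) Aᵀ hdet
  refine ⟨(Pi.basisFun ℤ (Fin n)).map e, ?_⟩
  have hb (j : Fin n) : (Pi.basisFun ℤ (Fin n)).map e j = A j := by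
    rw [Module.Basis.map_apply]
    change Matrix.toLin (Pi.basisFun ℤ (Fin n)) (Pi.basisFun ℤ (Fin n)) Aᵀ _ = _
    rw [Matrix.toLin_eq_toLin', Matrix.toLin'_apply, Pi.basisFun_apply, mulVec_single_one]
    rfl
  rintro _ ⟨⟨j, hj⟩, rfl⟩
  refine ⟨j, ?_⟩
  rw [hb]
  simp only [stdThen]
  split_ifs with h
  · rw [hA, updateRow_ne h.ne]
    ext l
    simp [Matrix.one_apply, Pi.single_apply, eq_comm]
  · rw [le_antisymm hj (not_lt.mp h), hA, updateRow_self]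

/-- Otherwise v is a combination of the preceding standard vectors, against linear independence. -/
theorem IsPrimitiveSet.exists_ne_zero {n : ℕ} {i : Fin n} {v : Fin n → ℤ}
    (h : IsPrimitiveSet (stdThen i v)) : ∃ j, i ≤ j ∧ v j ≠ 0 := by
  obtain ⟨hinj, b, hb⟩ := h
  by_contra! hcon
  have hli : LinearIndependent ℤ (stdThen i v) :=
    (linearIndepOn_id_range_iff hinj).mp (b.linearIndependent.linearIndepOn_id.mono hb)
  have hrel : ∑ j : Set.Iic i, (if (j : Fin n) < i then v j else -1) • stdThen i v j = 0 := by
    ext l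
    simp only [Finset.sum_apply, Pi.smul_apply, smul_eq_mul, Pi.zero_apply, stdThen]
    rw [← Finset.add_sum_erase _ _ (Finset.mem_univ (⟨i, Set.self_mem_Iic⟩ : Set.Iic i))]
    have hlt (j) (hj : j ∈ Finset.univ.erase (⟨i, Set.self_mem_Iic⟩ : Set.Iic i)) : (j : Fin n) < i :=
      lt_of_le_of_ne j.2 fun h => Finset.ne_of_mem_erase hj (Subtype.ext h)
    rw [Finset.sum_congr rfl fun j hj => by rw [if_pos (hlt j hj), if_pos (hlt j hj)]]
    simp only [lt_self_iff_false, if_false]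
    by_cases hl : l < i
    · rw [Finset.sum_eq_single (⟨l, hl.le⟩ : Set.Iic i)]
      · simp
      · intro j _ hj
        have : l ≠ j := fun h => hj (Subtype.ext h.symm)
        simp [this]
      · intro hj
        exact absurd (Finset.mem_erase.mpr ⟨fun h => hl.ne (congrArg Subtype.val h), Finset.mem_univ _⟩) hj
    · rw [hcon l (not_lt.mp hl), Finset.sum_eq_zero]
      · simp
      · intro j hj
        have : l ≠ j := fun h => hl (h ▸ hlt j hj)
        simp [this]
  have h0 := Fintype.linearIndependent_iff.mp hli _ hrel ⟨i, Set.self_mem_Iic⟩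
  simp at h0

theorem IsMinkowskiReduced.isUnitMinimal {n : ℕ} {S : Matrix (Fin n) (Fin n) ℝ}
    (h : IsMinkowskiReduced S) : IsUnitMinimal S := fun v k hk =>
  (h.2 k).2 ⟨v, isPrimitiveSet_stdThen k v hk, rfl⟩

theorem IsSupportMinimal.isMinkowskiReduced {n : ℕ} {S : Matrix (Fin n) (Fin n) ℝ}
    (hS : S.PosDef) (hmono : Monotone fun i => S i i) (h : IsSupportMinimal S) :
    IsMinkowskiReduced S := by
  refine ⟨hS, fun i => ⟨⟨Pi.single i 1, isPrimitiveSet_stdThen i _ (by simp),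
    quadValue_single S i⟩, ?_⟩⟩
  rintro _ ⟨v, hv, rfl⟩
  obtain ⟨j, hij, hj⟩ := IsPrimitiveSet.exists_ne_zero hv
  exact (hmono hij).trans (h v j hj)

/-! ### Permutation invariance -/

theorem act_permMatrix {n : ℕ} {g : GL (Fin n) ℤ} {σ : Equiv.Perm (Fin n)}
    (hg : (g : Matrix (Fin n) (Fin n) ℤ) = σ.permMatrix ℤ) (S : Matrix (Fin n) (Fin n) ℝ) :
    act g S = S.submatrix σ σ := by
  have h : (g : Matrix (Fin n) (Fin n) ℤ).map (Int.cast : ℤ → ℝ) = σ.permMatrix ℝ := by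
    rw [hg]
    ext i j
    simp [Equiv.Perm.permMatrix, PEquiv.toMatrix_apply]
  rw [act, h, transpose_permMatrix]
  ext i j
  rw [PEquiv.toMatrix_toPEquiv_mul, PEquiv.mul_toMatrix_toPEquiv]
  rfl

theorem quadValue_submatrix {n : ℕ} (S : Matrix (Fin n) (Fin n) ℝ) (σ : Equiv.Perm (Fin n))
    (v : Fin n → ℤ) : quadValue (S.submatrix σ σ) (v ∘ σ) = quadValue S v := by
  simp only [quadValue, dotProduct, mulVec, submatrix_apply, Function.comp_apply]
  rw [← Equiv.sum_comp σ (fun i => (v i : ℝ) * ∑ j, S i j * (v j : ℝ))]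
  refine Finset.sum_congr rfl fun i _ => ?_
  rw [← Equiv.sum_comp σ (fun j => S (σ i) j * (v j : ℝ))]

theorem isSupportMinimal_submatrix {n : ℕ} {S : Matrix (Fin n) (Fin n) ℝ}
    {σ : Equiv.Perm (Fin n)} : IsSupportMinimal (S.submatrix σ σ) ↔ IsSupportMinimal S := by
  constructor
  · intro h v k hk
    have := h (v ∘ σ) (σ.symm k) (by simpa using hk)
    rwa [quadValue_submatrix, submatrix_apply, Equiv.apply_symm_apply] at this
  · intro h v k hk
    have hv : v = (v ∘ σ.symm) ∘ σ := by ext; simp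
    rw [hv, quadValue_submatrix, submatrix_apply]
    exact h _ _ (by simpa using hk)

end LatticeReduction

theorem mainTheorem3 (n : ℕ) (hn : n ≤ 4) (S : Matrix (Fin n) (Fin n) ℝ) (hS : S.PosDef) :
    LatticeReduction.IsVenkovReduced (1 : Matrix (Fin n) (Fin n) ℝ) S ↔
      ∃ g : Matrix.GeneralLinearGroup (Fin n) ℤ,
        LatticeReduction.IsPermutationMatrix g ∧
          LatticeReduction.IsMinkowskiReduced (LatticeReduction.act g S) := by
  constructor
  · intro h
    have hsup := h.isUnitMinimal.isSupportMinimal hn fun i => hS.diag_pos.le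
    set σ := Tuple.sort fun i => S i i
    have hdet : IsUnit (σ.permMatrix ℤ).det := by
      rw [Matrix.det_permutation]
      exact (Equiv.Perm.sign σ).isUnit
    have hg : (Matrix.GeneralLinearGroup.mk'' _ hdet : Matrix.GeneralLinearGroup (Fin n) ℤ).val =
      σ.permMatrix ℤ := rfl
    refine ⟨_, ⟨σ, hg⟩, ?_⟩
    rw [LatticeReduction.act_permMatrix hg]
    exact (LatticeReduction.isSupportMinimal_submatrix.mpr hsup).isMinkowskiReduced (hS.submatrix σ.injective)
      (Tuple.monotone_sort fun i => S i i)
  · rintro ⟨g, ⟨σ, hg⟩, h⟩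
    rw [LatticeReduction.act_permMatrix hg] at h
    exact (LatticeReduction.isSupportMinimal_submatrix.mp
      (h.isUnitMinimal.isSupportMinimal hn fun i => h.1.diag_pos.le)).isVenkovReduced hS
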